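/- An affine formula is an expression built from variables by means of $\cap$ and $\cup$ (no complements, no constants). An affine statement is $f\subset g$ or $f=g$ with $f,g$ affine formulas, where $\subset$ is not necessarily strict. An affine configuration $C$ with $m$ variables is a Boolean expression, using $\lor,\land,\neg$, in affine statements in the variables $x_1,\dots,x_m$ (not all of which need to occur). In the Boolean lattice $2^{[n]}$ the symbols $\subset,\cap,\cup$ have their usual meaning; in the grid $[k]^d$, where $[k]=\{1,\dots,k\}$, $a\subset b$ means $a_i\le b_i$ for all $i$, and $\cap$ and $\cup$ are the coordinatewise minimum and maximum. A subset $H$ of $2^{[n]}$ or of $[k]^d$ contains $C$ if there are $m$ distinct elements of $H$ that, substituted for $x_1,\dots,x_m$ in some order, satisfy $C$; otherwise $H$ avoids $C$. Let $\mathrm{ex}(n,C)$ be the maximum size of a family $H\subset 2^{[n]}$ avoiding $C$, and $\mathrm{ex}(k,d,C)$ the maximum size of a set $H\subset[k]^d$ avoiding $C$. **Theorem.** Let $C$ be an affine configuration, let $d$ be a positive integer, and let $c,\alpha>0$ be real numbers such that $\mathrm{ex}(k,d,C)\le c\,k^{d-\alpha}$ holds for every sufficiently large positive integer $k$. Then $$\mathrm{ex}(n,C)\le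 (1+o(1))\,c\left(\frac{2d}{\pi n}\right)^{\alpha/2}2^n ,$$ where $o(1)$ tends to $0$ as $n\to\infty$ with $C,d,c,\alpha$ fixed. -/

import Mathlib

open Filter Topology

/-- Affine formulas in the variables `x₀, …, x_{m-1}`: built from variables, `∩` and `∪` only. -/
inductive AffineFormula (m : ℕ) : Type where
  | var (i : Fin m) : AffineFormula m
  | inter (f g : AffineFormula m) : AffineFormula m
  | union (f g : AffineFormula m) : AffineFormula m

/-- The value of an affine formula, with `∩` read as the meet and `∪` as the join of `L`. In
`Finset (Fin n)` these are intersection and union; in a grid they are the coordinatewise minimum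
and maximum. -/
def AffineFormula.eval {m : ℕ} {L : Type*} [Lattice L] (x : Fin m → L) : AffineFormula m → L
  | .var i => x i
  | .inter f g => f.eval x ⊓ g.eval x
  | .union f g => f.eval x ⊔ g.eval x

/-- Affine configurations with `m` variables: Boolean expressions (using `∨`, `∧`, `¬`) in the
affine statements `f ⊂ g` and `f = g`. A variable need not occur in the expression. -/
inductive AffineConfiguration (m : ℕ) : Type where
  | subset (f g : AffineFormula m) : AffineConfiguration m
  | eq (f g : AffineFormula m) : AffineConfiguration m
  | or (A B : AffineConfiguration m) : AffineConfiguration m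
  | and (A B : AffineConfiguration m) : AffineConfiguration m
  | not (A : AffineConfiguration m) : AffineConfiguration m

namespace AffineConfiguration

/-- The elements `x₀, …, x_{m-1}` of `L` satisfy the configuration; `⊂` is the (non-strict) order
of `L`: inclusion of sets, or coordinatewise comparison in a grid. -/
def Satisfies {m : ℕ} {L : Type*} [Lattice L] (x : Fin m → L) : AffineConfiguration m → Prop
  | .subset f g => f.eval x ≤ g.eval x
  | .eq f g => f.eval x = g.eval x
  | .or A B => A.Satisfies x ∨ B.Satisfies x
  | .and A B => A.Satisfies x ∧ B.Satisfies x
  | .not A => ¬ A.Satisfies x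

/-- `H` contains `C` if some `m` distinct elements of `H` satisfy `C`. -/
def ContainedIn {m : ℕ} {L : Type*} [Lattice L] (C : AffineConfiguration m) (H : Finset L) : Prop :=
  ∃ x : Fin m → L, Function.Injective x ∧ (∀ i, x i ∈ H) ∧ C.Satisfies x

open Classical in
/-- The size of the largest subset of the finite lattice `L` that avoids `C`. -/
noncomputable def exIn {m : ℕ} (L : Type*) [Lattice L] [Fintype L] (C : AffineConfiguration m) :
    ℕ :=
  ((Finset.univ : Finset (Finset L)).filter fun H => ¬ C.ContainedIn H).sup Finset.card

/-- `ex(n, C)`: the size of the largest family of subsets of an `n`-element set avoiding `C`. -/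
noncomputable def exCube {m : ℕ} (n : ℕ) (C : AffineConfiguration m) : ℕ :=
  C.exIn (Finset (Fin n))

/-- `ex(k, d, C)`: the size of the largest subset of the grid `[k]^d`, with its coordinatewise
order, avoiding `C`. -/
noncomputable def exGrid {m : ℕ} (k d : ℕ) (C : AffineConfiguration m) : ℕ :=
  C.exIn (Fin d → Fin k)

end AffineConfiguration

/-! An injective lattice homomorphism preserves and reflects every affine configuration. So if
copies of a lattice `A` cover `B` uniformly, averaging over the copies shows that a `C`-avoiding
subset of `B` has density at most `C.exIn A / |A|` (`exIn_mul_card_le`). To cover `2^[n]` by copies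
of `[k]^d`, take `d` disjoint blocks of size `N = 2j`, `j = ⌊n/(2d)⌋`, and fix the trace on the
leftover elements (`cubeSlices`). In each block random `k`-chains cover `2^[N]` uniformly as soon as
no layer exceeds `2^N / k` (`chainEmbeddings`), and copies multiply over blocks (`pi`). The largest
admissible `k` is `⌊4^j / centralBinom j⌋`; by Wallis `k² ~ πn/(2d)`, so the density bound `c
k^(-α)` is the one claimed. -/

namespace AffineConfiguration

/-! ### Configurations under lattice homomorphisms -/

theorem eval_latticeHom {m : ℕ} {A B : Type*} [Lattice A] [Lattice B] (φ : LatticeHom A B)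
    (x : Fin m → A) (f : AffineFormula m) :
    f.eval (fun i => φ (x i)) = φ (f.eval x) := by
  induction f with
  | var i => rfl
  | inter f g hf hg => simp [AffineFormula.eval, hf, hg]
  | union f g hf hg => simp [AffineFormula.eval, hf, hg]

/-- Injectivity reflects equations, hence also the order, since `a ≤ b` means `a ⊓ b = a`. The
equivalence, rather than one implication, is what carries negations through. -/
theorem satisfies_latticeHom_iff {m : ℕ} {A B : Type*} [Lattice A] [Lattice B]
    (φ : LatticeHom A B) (hφ : Function.Injective φ) (x : Fin m → A)
    (C : AffineConfiguration m) : C.Satisfies (fun i => φ (x i)) ↔ C.Satisfies x := by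
  induction C with
  | subset f g =>
    simp only [Satisfies, eval_latticeHom]
    rw [← inf_eq_left, ← map_inf φ, hφ.eq_iff, inf_eq_left]
  | eq f g => simp only [Satisfies, eval_latticeHom, hφ.eq_iff]
  | or A B hA hB => simp only [Satisfies, hA, hB]
  | and A B hA hB => simp only [Satisfies, hA, hB]
  | not A hA => simp only [Satisfies, hA]

theorem card_le_exIn {m : ℕ} {L : Type*} [Lattice L] [Fintype L] {C : AffineConfiguration m}
    {H : Finset L} (hH : ¬ C.ContainedIn H) : H.card ≤ C.exIn L := by
  classical
  unfold exIn
  exact Finset.le_sup (f := Finset.card) (by simpa using hH)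

theorem exIn_le {m : ℕ} {L : Type*} [Lattice L] [Fintype L] {C : AffineConfiguration m} {M : ℕ}
    (h : ∀ H : Finset L, ¬ C.ContainedIn H → H.card ≤ M) : C.exIn L ≤ M := by
  classical
  unfold exIn
  exact Finset.sup_le fun H hH => h H (by simpa using hH)

end AffineConfiguration

/-! ### Averaging over uniform embeddings -/

/-- A finite family of injective lattice homomorphisms `A → B` whose images cover every element
of `B` the same positive number of times. -/
structure UniformEmbeddings (A B ι : Type*) [Lattice A] [Lattice B] where
  /-- The members of the family. -/
  hom : ι → LatticeHom A B
  injective : ∀ j, Function.Injective (hom j)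
  /-- The number of times each element is covered. -/
  mult : ℕ
  mult_pos : 0 < mult
  card_fiber : ∀ b, Nat.card {p : ι × A // hom p.1 p.2 = b} = mult

namespace UniformEmbeddings

variable {A B ι : Type*} [Lattice A] [Lattice B] [Fintype A] [Fintype ι]

theorem card_mul_mult (U : UniformEmbeddings A B ι) (H : Finset B) :
    H.card * U.mult = Nat.card {p : ι × A // U.hom p.1 p.2 ∈ H} := by
  classical
  have h := Finset.card_eq_sum_card_fiberwise (f := fun p : ι × A => U.hom p.1 p.2)
    (s := Finset.univ.filter fun p : ι × A => U.hom p.1 p.2 ∈ H) (t := H)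
    (fun p hp => by simpa using hp)
  rw [Nat.card_eq_fintype_card, Fintype.card_subtype, h, ← smul_eq_mul, ← Finset.sum_const]
  refine Finset.sum_congr rfl fun b hb => ?_
  rw [← U.card_fiber b, Nat.card_eq_fintype_card, Fintype.card_subtype, Finset.filter_filter]
  congr 1
  ext p
  simp only [Finset.mem_filter, Finset.mem_univ, true_and]
  constructor
  · rintro rfl
    exact ⟨hb, rfl⟩
  · exact fun h => h.2

variable [Fintype B]

/-- The density of an avoiding set cannot grow along uniform embeddings. -/
theorem exIn_mul_card_le (U : UniformEmbeddings A B ι) {m : ℕ} (C : AffineConfiguration m) :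
    C.exIn B * Fintype.card A ≤ Fintype.card B * C.exIn A := by
  classical
  have htotal : Fintype.card B * U.mult = Fintype.card ι * Fintype.card A := by
    have := U.card_mul_mult Finset.univ
    simpa [Finset.card_univ] using this
  -- Double count the pairs `(j, a)` whose image lies in `H`: each element of `H` accounts for
  -- `mult` of them, and each `j` for at most `C.exIn A`, because the preimage of `H` under `hom j`
  -- avoids `C`.
  have key : ∀ H : Finset B, ¬ C.ContainedIn H →
      H.card * U.mult ≤ Fintype.card ι * C.exIn A := by
    intro H hH
    have hfib : Nat.card {p : ι × A // U.hom p.1 p.2 ∈ H}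
        = ∑ j : ι, (Finset.univ.filter fun a : A => U.hom j a ∈ H).card := by
      rw [Nat.card_eq_fintype_card, Fintype.card_subtype]
      simp only [Finset.card_filter]
      rw [Fintype.sum_prod_type]
    rw [U.card_mul_mult, hfib, ← smul_eq_mul (Fintype.card ι), ← Finset.card_univ,
      ← Finset.sum_const]
    refine Finset.sum_le_sum fun j _ => AffineConfiguration.card_le_exIn ?_
    rintro ⟨x, hx, hxH, hC⟩
    refine hH ⟨fun i => U.hom j (x i), (U.injective j).comp hx, fun i => by simpa using hxH i, ?_⟩
    exact (AffineConfiguration.satisfies_latticeHom_iff _ (U.injective j) x C).2 hC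
  have hex : C.exIn B * U.mult ≤ Fintype.card ι * C.exIn A := by
    have : C.exIn B ≤ Fintype.card ι * C.exIn A / U.mult :=
      AffineConfiguration.exIn_le fun H hH => (Nat.le_div_iff_mul_le U.mult_pos).2 (key H hH)
    exact (Nat.le_div_iff_mul_le U.mult_pos).1 this
  refine Nat.le_of_mul_le_mul_right ?_ U.mult_pos
  calc C.exIn B * Fintype.card A * U.mult = C.exIn B * U.mult * Fintype.card A := by ring
    _ ≤ Fintype.card ι * C.exIn A * Fintype.card A := Nat.mul_le_mul_right _ hex
    _ = Fintype.card ι * Fintype.card A * C.exIn A := by ring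
    _ = Fintype.card B * C.exIn A * U.mult := by rw [← htotal]; ring

/-- The coordinatewise product of uniform embeddings. -/
def pi (U : UniformEmbeddings A B ι) (d : ℕ) :
    UniformEmbeddings (Fin d → A) (Fin d → B) (Fin d → ι) where
  hom j :=
    { toFun := fun a i => U.hom (j i) (a i)
      map_sup' := fun a b => by ext i; simp
      map_inf' := fun a b => by ext i; simp }
  injective j a b h := by
    ext i
    exact U.injective (j i) (congrFun h i)
  mult := U.mult ^ d
  mult_pos := pow_pos U.mult_pos d
  card_fiber b := by
    have e : {p : (Fin d → ι) × (Fin d → A) // (fun i => U.hom (p.1 i) (p.2 i)) = b} ≃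
        ∀ i, {p : ι × A // U.hom p.1 p.2 = b i} :=
      { toFun := fun p i => ⟨(p.1.1 i, p.1.2 i), congrFun p.2 i⟩
        invFun := fun q => ⟨(fun i => (q i).1.1, fun i => (q i).1.2), funext fun i => (q i).2⟩
        left_inv := fun p => rfl
        right_inv := fun q => rfl }
    refine (Nat.card_congr e).trans ?_
    rw [Nat.card_pi]
    simp [U.card_fiber]

end UniformEmbeddings

/-! ### Cutting the cube into blocks -/

open Classical in
/-- Fixing the trace on the last `r` elements embeds a product of Boolean lattices into a larger
Boolean lattice. -/
noncomputable def cubeSlices {n d N r : ℕ}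
    (e : Fin n ≃ (Fin d × Fin N) ⊕ Fin r) :
    UniformEmbeddings (Fin d → Finset (Fin N)) (Finset (Fin n)) (Finset (Fin r)) where
  hom T :=
    { toFun := fun f => Finset.univ.filter fun x => Sum.elim (fun p => p.2 ∈ f p.1) (· ∈ T) (e x)
      map_sup' := fun f g => by
        ext x
        rcases h : e x with p | z <;> simp [h]
      map_inf' := fun f g => by
        ext x
        rcases h : e x with p | z <;> simp [h] }
  injective T f g h := by
    ext i y
    have := congrArg (fun s => e.symm (Sum.inl (i, y)) ∈ s) h
    simpa using this
  -- A set is determined by its traces on the blocks and on the remainder, so the slices partition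
  -- the cube.
  mult := 1
  mult_pos := one_pos
  card_fiber b := by
    rw [Nat.card_eq_one_iff_exists]
    refine ⟨⟨(Finset.univ.filter fun z => e.symm (Sum.inr z) ∈ b,
      fun i => Finset.univ.filter fun y => e.symm (Sum.inl (i, y)) ∈ b), ?_⟩, ?_⟩
    · ext x
      obtain ⟨p | z, rfl⟩ := e.symm.surjective x <;> simp
    · rintro ⟨⟨T, f⟩, rfl⟩
      refine Subtype.ext (Prod.ext ?_ ?_)
      · ext z
        simp
      · funext i
        ext y
        simp

/-! ### Uniform covering of a cube by chains -/

section Chains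

/-- `k` times the number of subsets of an `N`-element set with fewer than `l` elements. -/
def layerStart (N k l : ℕ) : ℕ := ∑ i ∈ Finset.range l, k * N.choose i

theorem layerStart_succ (N k l : ℕ) :
    layerStart N k (l + 1) = layerStart N k l + k * N.choose l :=
  Finset.sum_range_succ _ _

theorem layerStart_mono (N k : ℕ) : Monotone (layerStart N k) :=
  monotone_nat_of_le_succ fun l => by rw [layerStart_succ]; exact Nat.le_add_right _ _

theorem layerStart_last (N k : ℕ) : layerStart N k (N + 1) = k * 2 ^ N := by
  rw [layerStart, ← Finset.mul_sum, Nat.sum_range_choose]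

/-- The layer `l ≤ N` whose interval `[layerStart l, layerStart (l + 1))` contains `t`. -/
def layer (N k t : ℕ) : ℕ := Nat.findGreatest (fun l => layerStart N k l ≤ t) N

theorem layer_le (N k t : ℕ) : layer N k t ≤ N := Nat.findGreatest_le N

theorem layerStart_layer_le (N k t : ℕ) : layerStart N k (layer N k t) ≤ t :=
  Nat.findGreatest_spec (P := fun l => layerStart N k l ≤ t) (Nat.zero_le N)
    (by simp [layerStart])

theorem lt_layerStart_layer_succ {N k t : ℕ} (ht : t < k * 2 ^ N) :
    t < layerStart N k (layer N k t + 1) := by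
  rcases (layer_le N k t).eq_or_lt with h | h
  · rwa [h, layerStart_last]
  · exact not_le.1 (Nat.findGreatest_is_greatest (P := fun l => layerStart N k l ≤ t)
      (Nat.lt_succ_self _) h)

theorem layer_eq_iff {N k t l : ℕ} (ht : t < k * 2 ^ N) :
    layer N k t = l ↔ layerStart N k l ≤ t ∧ t < layerStart N k (l + 1) := by
  constructor
  · rintro rfl
    exact ⟨layerStart_layer_le N k t, lt_layerStart_layer_succ ht⟩
  · rintro ⟨h₁, h₂⟩
    have h₃ := layerStart_layer_le N k t
    have h₄ := lt_layerStart_layer_succ ht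
    by_contra hne
    rcases Nat.lt_or_gt_of_ne hne with h | h
    · have := layerStart_mono N k (Nat.succ_le_of_lt h)
      simp only [Nat.succ_eq_add_one] at this
      omega
    · have := layerStart_mono N k (Nat.succ_le_of_lt h)
      simp only [Nat.succ_eq_add_one] at this
      omega

/-- Each layer occupies an interval of length at most `2 ^ N`, so two points at distance at least `2
^ N` cannot share one. -/
theorem layer_lt_layer {N k s t : ℕ} (hk : ∀ i, k * N.choose i ≤ 2 ^ N) (ht : t < k * 2 ^ N)
    (hst : s + 2 ^ N ≤ t) : layer N k s < layer N k t := by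
  by_contra! h
  have h₁ := layerStart_layer_le N k s
  have h₂ := lt_layerStart_layer_succ ht
  have h₃ := layerStart_succ N k (layer N k t)
  have h₄ := layerStart_mono N k h
  have h₅ := hk (layer N k t)
  omega

theorem card_layer_eq {N k l : ℕ} (hl : l ≤ N) :
    Nat.card {t : Fin (k * 2 ^ N) // layer N k t = l} = k * N.choose l := by
  have hlast : layerStart N k (l + 1) ≤ k * 2 ^ N := by
    rw [← layerStart_last]
    exact layerStart_mono N k (by omega)
  have e : {t : Fin (k * 2 ^ N) // layer N k t = l} ≃
      Finset.Ico (layerStart N k l) (layerStart N k (l + 1)) :=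
    { toFun := fun t => ⟨t.1, Finset.mem_Ico.2 ((layer_eq_iff t.1.2).1 t.2)⟩
      invFun := fun t => ⟨⟨t.1, (Finset.mem_Ico.1 t.2).2.trans_le hlast⟩,
        (layer_eq_iff ((Finset.mem_Ico.1 t.2).2.trans_le hlast)).2 (Finset.mem_Ico.1 t.2)⟩
      left_inv := fun t => rfl
      right_inv := fun t => rfl }
  rw [Nat.card_congr e, Nat.card_eq_fintype_card, Fintype.card_coe, Nat.card_Ico, layerStart_succ]
  omega

/-- The set of the first `l` elements in a numbering. -/
def initialSegment {N : ℕ} (f : Numbering (Fin N)) (l : ℕ) : Finset (Fin N) :=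
  Finset.univ.filter fun y => (f y : ℕ) < l

theorem mem_initialSegment {N : ℕ} {f : Numbering (Fin N)} {l : ℕ} {y : Fin N} :
    y ∈ initialSegment f l ↔ (f y : ℕ) < l := by
  simp [initialSegment]

theorem card_initialSegment {N : ℕ} (f : Numbering (Fin N)) {l : ℕ} (hl : l ≤ N) :
    (initialSegment f l).card = l := by
  have h : (initialSegment f l).card
      = (Finset.univ.filter fun z : Fin (Fintype.card (Fin N)) => (z : ℕ) < l).card :=
    Finset.card_equiv f fun y => by simp [initialSegment]
  rw [h, Fin.card_filter_val_lt, Fintype.card_fin, min_eq_right hl]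

theorem initialSegment_eq_iff {N : ℕ} {f : Numbering (Fin N)} {l : ℕ} (hl : l ≤ N)
    {s : Finset (Fin N)} :
    initialSegment f l = s ↔ l = s.card ∧ f ∈ Numbering.prefixed s := by
  constructor
  · rintro rfl
    rw [Numbering.mem_prefixed, Numbering.IsPrefix, card_initialSegment f hl]
    exact ⟨rfl, fun y => mem_initialSegment⟩
  · rintro ⟨rfl, h⟩
    ext y
    rw [mem_initialSegment, Numbering.mem_prefixed.1 h y]

theorem initialSegment_mono {N : ℕ} (f : Numbering (Fin N)) : Monotone (initialSegment f) :=
  fun _ _ h _ hy => mem_initialSegment.2 ((mem_initialSegment.1 hy).trans_le h)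

/-- Systematic sampling of the layers along random maximal chains: if no layer has more than
`2 ^ N / k` elements, then `k`-element chains cover the Boolean lattice uniformly. -/
def chainEmbeddings {N k : ℕ} (hk₀ : 0 < k) (hk : ∀ i, k * N.choose i ≤ 2 ^ N) :
    UniformEmbeddings (Fin k) (Finset (Fin N)) (Fin (2 ^ N) × Numbering (Fin N)) :=
  -- The offset `u` selects the sample points `u + 2 ^ N * i`, which fall in distinct layers.
  have hlt : ∀ (u : Fin (2 ^ N)) {i j : Fin k}, i < j →
      layer N k (finProdFinEquiv (i, u)) < layer N k (finProdFinEquiv (j, u)) := by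
    intro u i j hij
    refine layer_lt_layer hk (Fin.is_lt _) ?_
    have h := Nat.mul_le_mul_left (2 ^ N) (Nat.succ_le_of_lt (Fin.lt_def.1 hij))
    rw [Nat.succ_eq_add_one, mul_add, mul_one] at h
    simp only [finProdFinEquiv_apply_val]
    omega
  { hom := fun p => OrderHomClass.toLatticeHom _ _
      (⟨fun i => initialSegment p.2 (layer N k (finProdFinEquiv (i, p.1))),
        (initialSegment_mono p.2).comp
          (StrictMono.monotone fun _ _ hij => hlt p.1 hij)⟩ : Fin k →o Finset (Fin N))
    injective := fun p i j h => by
      have h' := congrArg Finset.card h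
      simp only [OrderHomClass.to_lattice_hom_apply, OrderHom.coe_mk] at h'
      rw [card_initialSegment _ (layer_le _ _ _), card_initialSegment _ (layer_le _ _ _)] at h'
      rcases lt_trichotomy i j with hij | hij | hij
      · exact absurd h' (hlt p.1 hij).ne
      · exact hij
      · exact absurd h' (hlt p.1 hij).ne'
    -- For `l = s.card` there are `k * N.choose l` sample points in layer `l` and `l! (N - l)!`
    -- numberings that start with `s`; the product does not depend on `l`.
    mult := k * N.factorial
    mult_pos := Nat.mul_pos hk₀ (Nat.factorial_pos N)
    card_fiber := fun s => by
      have hs : s.card ≤ N := by simpa using s.card_le_univ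
      have e : {p : (Fin (2 ^ N) × Numbering (Fin N)) × Fin k //
          initialSegment p.1.2 (layer N k (finProdFinEquiv (p.2, p.1.1))) = s} ≃
          {t : Fin (k * 2 ^ N) // layer N k t = s.card} × Numbering.prefixed s :=
        { toFun := fun p =>
            (⟨finProdFinEquiv (p.1.2, p.1.1.1), ((initialSegment_eq_iff (layer_le _ _ _)).1 p.2).1⟩,
              ⟨p.1.1.2, ((initialSegment_eq_iff (layer_le _ _ _)).1 p.2).2⟩)
          invFun := fun q =>
            ⟨(((finProdFinEquiv.symm q.1.1).2, q.2.1), (finProdFinEquiv.symm q.1.1).1),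
              (initialSegment_eq_iff (layer_le _ _ _)).2
                ⟨by rw [Prod.mk.eta, Equiv.apply_symm_apply]; exact q.1.2, q.2.2⟩⟩
          left_inv := fun p => by
            apply Subtype.ext
            simp
          right_inv := fun q => by
            refine Prod.ext (Subtype.ext ?_) (Subtype.ext rfl)
            exact Equiv.apply_symm_apply _ _ }
      refine (Nat.card_congr e).trans ?_
      rw [Nat.card_prod, card_layer_eq hs, Nat.card_eq_fintype_card, Fintype.card_coe,
        Numbering.card_prefixed, Fintype.card_fin, mul_assoc, ← mul_assoc (N.choose _),
        Nat.choose_mul_factorial_mul_factorial hs] }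

end Chains

/-! ### From the cube to the grid, and the size of `k` -/

theorem exCube_mul_pow_le {m : ℕ} (C : AffineConfiguration m) {n d N k : ℕ} (hn : d * N ≤ n)
    (hk₀ : 0 < k) (hk : ∀ i, k * N.choose i ≤ 2 ^ N) :
    C.exCube n * k ^ d ≤ 2 ^ n * C.exGrid k d := by
  have e : Fin n ≃ (Fin d × Fin N) ⊕ Fin (n - d * N) :=
    (finCongr (by omega : n = d * N + (n - d * N))).trans
      (finSumFinEquiv.symm.trans (Equiv.sumCongr finProdFinEquiv.symm (Equiv.refl _)))
  have h₁ := (cubeSlices e).exIn_mul_card_le C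
  have h₂ := ((chainEmbeddings hk₀ hk).pi d).exIn_mul_card_le C
  simp only [Fintype.card_pi, Fintype.card_finset, Fintype.card_fin, Finset.prod_const,
    Finset.card_univ] at h₁ h₂
  refine Nat.le_of_mul_le_mul_right ?_ (pow_pos (pow_pos two_pos N) d)
  calc C.exCube n * k ^ d * (2 ^ N) ^ d = C.exCube n * (2 ^ N) ^ d * k ^ d := by ring
    _ ≤ 2 ^ n * C.exIn (Fin d → Finset (Fin N)) * k ^ d := Nat.mul_le_mul_right _ h₁
    _ = 2 ^ n * (C.exIn (Fin d → Finset (Fin N)) * k ^ d) := by ring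
    _ ≤ 2 ^ n * ((2 ^ N) ^ d * C.exGrid k d) := Nat.mul_le_mul_left _ h₂
    _ = 2 ^ n * C.exGrid k d * (2 ^ N) ^ d := by ring

/-- The largest `k` for which `k`-element chains can cover `2 ^ [2 j]` uniformly. -/
def chainLength (j : ℕ) : ℕ := 4 ^ j / j.centralBinom

theorem chainLength_mul_choose_le (j i : ℕ) : chainLength j * (2 * j).choose i ≤ 2 ^ (2 * j) := by
  calc chainLength j * (2 * j).choose i ≤ chainLength j * j.centralBinom :=
        Nat.mul_le_mul_left _ (Nat.choose_le_centralBinom i j)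
    _ ≤ 4 ^ j := Nat.div_mul_le_self _ _
    _ = 2 ^ (2 * j) := by rw [pow_mul]; norm_num

/-- The expression is exactly the Wallis partial product `W j`. -/
theorem tendsto_sq_four_pow_div_centralBinom :
    Tendsto (fun j : ℕ => ((4 : ℝ) ^ j / j.centralBinom) ^ 2 / (2 * j + 1)) atTop
      (𝓝 (Real.pi / 2)) := by
  refine Real.Wallis.tendsto_W_nhds_pi_div_two.congr fun j => ?_
  rw [Real.Wallis.W_eq_factorial_ratio, Nat.centralBinom_eq_two_mul_choose,
    Nat.cast_choose ℝ (by omega : j ≤ 2 * j), show 2 * j - j = j by omega,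
    show (2 : ℝ) ^ (4 * j) = (4 ^ j) ^ 2 by rw [← pow_mul, mul_comm j 2, pow_mul, pow_mul]; norm_num]
  have := Nat.cast_ne_zero (R := ℝ).2 (Nat.factorial_ne_zero j)
  have := Nat.cast_ne_zero (R := ℝ).2 (Nat.factorial_ne_zero (2 * j))
  field_simp

theorem tendsto_four_pow_div_centralBinom_atTop :
    Tendsto (fun j : ℕ => (4 : ℝ) ^ j / j.centralBinom) atTop atTop := by
  have h₁ : Tendsto (fun j : ℕ => (2 * (j : ℝ) + 1)) atTop atTop :=
    tendsto_atTop_add_const_right _ _ (tendsto_natCast_atTop_atTop.const_mul_atTop two_pos)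
  have h₂ := tendsto_sq_four_pow_div_centralBinom.pos_mul_atTop (by positivity) h₁
  have h₃ : Tendsto (fun j : ℕ => ((4 : ℝ) ^ j / j.centralBinom) ^ 2) atTop atTop := by
    refine h₂.congr fun j => ?_
    field_simp
  refine (Real.tendsto_sqrt_atTop.comp h₃).congr fun j => ?_
  exact Real.sqrt_sq (by positivity)

theorem chainLength_eq_floor (j : ℕ) : chainLength j = ⌊(4 : ℝ) ^ j / j.centralBinom⌋₊ := by
  rw [chainLength, ← Nat.floor_div_eq_div (K := ℝ)]
  push_cast
  rfl

theorem tendsto_chainLength_atTop : Tendsto chainLength atTop atTop := by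
  refine (tendsto_nat_floor_atTop.comp tendsto_four_pow_div_centralBinom_atTop).congr fun j => ?_
  exact (chainLength_eq_floor j).symm

/-- Rounding down is harmless because the rounded quantity tends to infinity. -/
theorem tendsto_chainLength_sq_div :
    Tendsto (fun j : ℕ => (chainLength j : ℝ) ^ 2 / (2 * j + 1)) atTop (𝓝 (Real.pi / 2)) := by
  have h := ((tendsto_nat_floor_div_atTop (R := ℝ)).comp
    tendsto_four_pow_div_centralBinom_atTop).pow 2 |>.mul tendsto_sq_four_pow_div_centralBinom
  rw [one_pow, one_mul] at h
  refine h.congr fun j => ?_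
  have := Nat.cast_ne_zero (R := ℝ).2 j.centralBinom_ne_zero
  simp only [Function.comp_apply, chainLength_eq_floor]
  field_simp

theorem tendsto_two_mul_div_add_one_div {d : ℕ} (hd : 0 < d) :
    Tendsto (fun n : ℕ => (2 * ((n / (2 * d) : ℕ) : ℝ) + 1) / n) atTop (𝓝 ((d : ℝ)⁻¹)) := by
  have hd' : (0 : ℝ) < d := Nat.cast_pos.2 hd
  have h₁ := ((tendsto_nat_floor_mul_div_atTop (R := ℝ)
    (a := (2 * (d : ℝ))⁻¹) (by positivity)).comp tendsto_natCast_atTop_atTop).const_mul 2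
  have h₂ := h₁.add (tendsto_inv_atTop_nhds_zero_nat (𝕜 := ℝ))
  have h₃ : 2 * (2 * (d : ℝ))⁻¹ + 0 = (d : ℝ)⁻¹ := by field_simp; ring
  rw [h₃] at h₂
  refine h₂.congr fun n => ?_
  have : ((n / (2 * d) : ℕ)) = ⌊(2 * (d : ℝ))⁻¹ * n⌋₊ := by
    rw [← Nat.floor_div_eq_div (K := ℝ)]
    push_cast
    rw [div_eq_inv_mul]
  rw [this, Function.comp_apply]
  ring

/-- With `k² ~ (π/2)(2j+1)` and `2j+1 ~ n/d`, the product `k² · 2d/(πn)` tends to 1; raise it to the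
power `-α/2`. -/
theorem tendsto_chainLength_rpow_ratio {d : ℕ} (hd : 0 < d) (α : ℝ) :
    Tendsto (fun n : ℕ => (chainLength (n / (2 * d)) : ℝ) ^ (-α) /
      (2 * (d : ℝ) / (Real.pi * n)) ^ (α / 2)) atTop (𝓝 1) := by
  have hd' : (0 : ℝ) < d := Nat.cast_pos.2 hd
  have hdiv : Tendsto (fun n : ℕ => n / (2 * d)) atTop atTop :=
    Nat.tendsto_div_const_atTop (by omega)
  have h := ((tendsto_chainLength_sq_div.comp hdiv).mul
    (tendsto_two_mul_div_add_one_div hd)).mul_const (2 * (d : ℝ) / Real.pi)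
  have hlim : Real.pi / 2 * (d : ℝ)⁻¹ * (2 * (d : ℝ) / Real.pi) = 1 := by
    have := Real.pi_ne_zero
    field_simp
  rw [hlim] at h
  have h' := h.rpow_const (p := -(α / 2)) (Or.inl one_ne_zero)
  rw [Real.one_rpow] at h'
  refine h'.congr' ?_
  filter_upwards [eventually_gt_atTop 0] with n hn
  have hn' : (0 : ℝ) < n := Nat.cast_pos.2 hn
  have heq : (chainLength (n / (2 * d)) : ℝ) ^ 2 / (2 * ((n / (2 * d) : ℕ) : ℝ) + 1) *
      ((2 * ((n / (2 * d) : ℕ) : ℝ) + 1) / n) * (2 * (d : ℝ) / Real.pi) =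
      (chainLength (n / (2 * d)) : ℝ) ^ 2 * (2 * (d : ℝ) / (Real.pi * n)) := by
    have : (2 * ((n / (2 * d) : ℕ) : ℝ) + 1) ≠ 0 := by positivity
    have := Real.pi_ne_zero
    generalize ((n / (2 * d) : ℕ) : ℝ) = x at *
    field_simp
  simp only [Function.comp_apply]
  rw [heq, Real.mul_rpow (by positivity) (by positivity), Real.rpow_neg (x := 2 * (d : ℝ) / _)
    (by positivity), ← div_eq_mul_inv, ← Real.rpow_natCast, ← Real.rpow_mul (by positivity)]
  congr 2
  push_cast
  ring

/-! ### Conclusion -/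

theorem eventually_exCube_le {m : ℕ} (C : AffineConfiguration m) {d : ℕ} (hd : 0 < d) {c α : ℝ}
    (hgrid : ∀ᶠ k : ℕ in atTop, (C.exGrid k d : ℝ) ≤ c * (k : ℝ) ^ ((d : ℝ) - α)) :
    ∀ᶠ n : ℕ in atTop,
      (C.exCube n : ℝ) ≤ c * (chainLength (n / (2 * d)) : ℝ) ^ (-α) * 2 ^ n := by
  have ht : Tendsto (fun n : ℕ => chainLength (n / (2 * d))) atTop atTop :=
    tendsto_chainLength_atTop.comp (Nat.tendsto_div_const_atTop (by omega))
  filter_upwards [ht.eventually hgrid, ht.eventually (eventually_gt_atTop 0)] with n hn hpos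
  have hdim : d * (2 * (n / (2 * d))) ≤ n := by
    calc d * (2 * (n / (2 * d))) = 2 * d * (n / (2 * d)) := by ring
      _ ≤ n := Nat.mul_div_le n (2 * d)
  have h := exCube_mul_pow_le C hdim hpos (chainLength_mul_choose_le _)
  have h' : (C.exCube n : ℝ) * (chainLength (n / (2 * d)) : ℝ) ^ d ≤
      2 ^ n * C.exGrid (chainLength (n / (2 * d))) d := by exact_mod_cast h
  generalize chainLength (n / (2 * d)) = k at *
  have hk : (0 : ℝ) < k := Nat.cast_pos.2 hpos
  refine le_of_mul_le_mul_right ?_ (pow_pos hk d)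
  calc (C.exCube n : ℝ) * (k : ℝ) ^ d ≤ 2 ^ n * C.exGrid k d := h'
    _ ≤ 2 ^ n * (c * (k : ℝ) ^ ((d : ℝ) - α)) := by gcongr
    _ = c * (k : ℝ) ^ (-α) * 2 ^ n * (k : ℝ) ^ d := by
      rw [sub_eq_add_neg, Real.rpow_add hk, Real.rpow_natCast]
      ring

theorem theorem3p1 {m : ℕ} (C : AffineConfiguration m) (d : ℕ) (hd : 0 < d) (c α : ℝ)
    (hc : 0 < c) (hα : 0 < α)
    (hgrid : ∀ᶠ k : ℕ in atTop, (C.exGrid k d : ℝ) ≤ c * (k : ℝ) ^ ((d : ℝ) - α)) :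
    ∃ δ : ℕ → ℝ, Tendsto δ atTop (𝓝 0) ∧
      ∀ n : ℕ, 1 ≤ n →
        (C.exCube n : ℝ) ≤
          (1 + δ n) * c * (2 * (d : ℝ) / (Real.pi * (n : ℝ))) ^ (α / 2) * 2 ^ n := by
  have hd' : (0 : ℝ) < d := Nat.cast_pos.2 hd
  have hscale : ∀ n : ℕ, 1 ≤ n →
      0 < c * (2 * (d : ℝ) / (Real.pi * (n : ℝ))) ^ (α / 2) * 2 ^ n := fun n hn => by
    have : (0 : ℝ) < n := Nat.cast_pos.2 hn
    positivity
  -- The relative excess makes the bound hold for every `n ≥ 1`; clipping it at 0 supplies the lower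
  -- side of the squeeze, as only upper bounds on `exCube` are known.
  refine ⟨fun n => max 0 ((C.exCube n : ℝ) /
    (c * (2 * (d : ℝ) / (Real.pi * (n : ℝ))) ^ (α / 2) * 2 ^ n) - 1), ?_, fun n hn => ?_⟩
  · have hlim := (tendsto_const_nhds (x := (0 : ℝ))).max
      ((tendsto_chainLength_rpow_ratio hd α).sub_const 1)
    rw [sub_self, max_self] at hlim
    refine tendsto_of_tendsto_of_tendsto_of_le_of_le' tendsto_const_nhds hlim
      (Eventually.of_forall fun n => le_max_left _ _) ?_
    filter_upwards [eventually_exCube_le C hd hgrid, eventually_ge_atTop 1] with n hn hn1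
    refine max_le_max le_rfl (sub_le_sub_right ?_ 1)
    rw [div_le_iff₀ (hscale n hn1)]
    refine hn.trans_eq ?_
    have : (0 : ℝ) < n := Nat.cast_pos.2 hn1
    have : (2 * (d : ℝ) / (Real.pi * (n : ℝ))) ^ (α / 2) ≠ 0 := by positivity
    field_simp
  · have h := le_max_right 0 ((C.exCube n : ℝ) /
      (c * (2 * (d : ℝ) / (Real.pi * (n : ℝ))) ^ (α / 2) * 2 ^ n) - 1)
    rw [sub_le_iff_le_add', div_le_iff₀ (hscale n hn)] at h
    refine h.trans_eq ?_
    ring
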